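/- For $q\in(1,2)$ consider the maps of the plane \begin{align*} S_0(x,y)&=\left(\tfrac{x}{3},\tfrac{y}{q}\right),\\ S_1(x,y)&=\left(\tfrac{x+1}{3},\left(\tfrac{2}{q}-1\right)(1-y)+\left(1-\tfrac1q\right)\right),\\ S_2(x,y)&=\left(\tfrac{x+2}{3},\tfrac{y}{q}+\left(1-\tfrac1q\right)\right), \end{align*} and let $K_q$ be the unique nonempty compact set with $K_q=S_0(K_q)\cup S_1(K_q)\cup S_2(K_q)$ (the graph of Okamoto's function with parameter $q$). For $y\in[0,1]$ let $K_q^{y}=\{x\in[0,1]:(x,y)\in K_q\}$ be the horizontal slice of $K_q$ at height $y$. Let $G=\frac{1+\sqrt5}{2}$ be the golden ratio. Then the following hold. \begin{enumerate} \item If $q\in(1,G)$, then for every $y\in(0,1)$ the slice $K_q^{y}$ is uncountable, and in fact it has positive Hausdorff dimension. \item If $q=G$, then the set of $y\in(0,1)$ for which $K_G^{y}$ is countably infinite is itself countably infinite, and for all other $y\in(0,1)$ the slice $K_G^{y}$ is uncountable. \item If $q\in(G,2)$, then the set of $y\in(0,1)$ for which $K_q^{y}$ has exactly one element is infinite, and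 for Lebesgue-almost every $y\in(0,1)$ the slice $K_q^{y}$ is uncountable. \end{enumerate} -/

import Mathlib

open Set MeasureTheory TopologicalSpace

/-- First coordinate map `v_i(x) = (x + i) / 3` of the Okamoto iterated function system. -/
noncomputable def okamotoV (i : Fin 3) (x : ℝ) : ℝ :=
  (x + (i : ℕ)) / 3

/-- Second coordinate maps `u_0, u_1, u_2` of the Okamoto iterated function system. -/
noncomputable def okamotoU (q : ℝ) (i : Fin 3) (y : ℝ) : ℝ :=
  ![y / q,
    (2 / q - 1) * (1 - y) + (1 - 1 / q),
    y / q + (1 - 1 / q)] i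

/-- The maps `S_i(x, y) = (v_i(x), u_i(y))` of the Okamoto iterated function system. For
`1 < q < 2` they are contractions of the plane that map the unit square into itself. -/
noncomputable def okamotoMap (q : ℝ) (i : Fin 3) (p : ℝ × ℝ) : ℝ × ℝ :=
  (okamotoV i p.1, okamotoU q i p.2)

/-- `K` is a nonempty compact set with `K = S_0(K) ∪ S_1(K) ∪ S_2(K)`. -/
def IsOkamotoAttractor (q : ℝ) (K : Set (ℝ × ℝ)) : Prop :=
  K.Nonempty ∧ IsCompact K ∧ K = ⋃ i : Fin 3, okamotoMap q i '' K

/-- The self-affine set `K_q` (the graph of Okamoto's function). For `1 < q < 2` there is exactly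
one nonempty compact invariant set (`existsUnique_isOkamotoAttractor` below), so that this union
is the union of a one-element family; see `isOkamotoAttractor_okamotoGraph`. -/
def okamotoGraph (q : ℝ) : Set (ℝ × ℝ) :=
  ⋃₀ {K | IsOkamotoAttractor q K}

/-- The horizontal slice of `K_q` at height `y`. -/
def okamotoSlice (q y : ℝ) : Set ℝ :=
  {x | x ∈ Icc (0 : ℝ) 1 ∧ (x, y) ∈ okamotoGraph q}

/-- Each `S_i` is a contraction, with a common ratio. -/
theorem exists_lipschitz_okamotoMap {q : ℝ} (h1 : 1 < q) (h2 : q < 2) :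
    ∃ r : NNReal, r < 1 ∧ ∀ i, LipschitzWith r (okamotoMap q i) := by
  have hq : 0 < q := by linarith
  have ha : 1 / q < 1 := by rw [div_lt_one hq]; exact h1
  have ha0 : 0 < 1 / q := by positivity
  have hb : 2 / q - 1 < 1 := by
    have : 2 / q = 2 * (1 / q) := by ring
    linarith
  have hb0 : 0 < 2 / q - 1 := by
    have : 1 < 2 / q := by rw [lt_div_iff₀ hq]; linarith
    linarith
  set r : ℝ := max (1 / 3) (max (1 / q) (2 / q - 1)) with hr
  have hr0 : 0 ≤ r := le_max_of_le_left (by norm_num)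
  have hr1 : r < 1 := by
    rw [hr]; exact max_lt (by norm_num) (max_lt ha hb)
  have hr3 : 1 / 3 ≤ r := le_max_left _ _
  have hra : 1 / q ≤ r := (le_max_left _ _).trans (le_max_right _ _)
  have hrb : 2 / q - 1 ≤ r := (le_max_right _ _).trans (le_max_right _ _)
  refine ⟨⟨r, hr0⟩, by exact_mod_cast hr1, fun i => LipschitzWith.of_dist_le_mul fun p p' => ?_⟩
  rw [Prod.dist_eq, Prod.dist_eq]
  change max (dist (okamotoV i p.1) (okamotoV i p'.1)) (dist (okamotoU q i p.2) (okamotoU q i p'.2))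
    ≤ r * _
  have hx : dist (okamotoV i p.1) (okamotoV i p'.1) ≤ r * dist p.1 p'.1 := by
    have : okamotoV i p.1 - okamotoV i p'.1 = (1 / 3) * (p.1 - p'.1) := by
      simp only [okamotoV]; ring
    rw [Real.dist_eq, Real.dist_eq, this, abs_mul, abs_of_pos (by norm_num : (0 : ℝ) < 1 / 3)]
    gcongr
  have hy : dist (okamotoU q i p.2) (okamotoU q i p'.2) ≤ r * dist p.2 p'.2 := by
    have key : ∃ c : ℝ, |c| ≤ r ∧ okamotoU q i p.2 - okamotoU q i p'.2 = c * (p.2 - p'.2) := by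
      fin_cases i
      · exact ⟨1 / q, by rwa [abs_of_pos ha0], by simp [okamotoU]; ring⟩
      · exact ⟨-(2 / q - 1), by rwa [abs_neg, abs_of_pos hb0], by simp [okamotoU]; ring⟩
      · exact ⟨1 / q, by rwa [abs_of_pos ha0], by simp [okamotoU]; ring⟩
    obtain ⟨c, hc, he⟩ := key
    rw [Real.dist_eq, Real.dist_eq, he, abs_mul]
    gcongr
  exact max_le (hx.trans (by gcongr; exact le_max_left _ _))
    (hy.trans (by gcongr; exact le_max_right _ _))

/-- There is exactly one nonempty compact set invariant under the Okamoto system. -/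
theorem existsUnique_isOkamotoAttractor {q : ℝ} (h1 : 1 < q) (h2 : q < 2) :
    ∃! K : Set (ℝ × ℝ), IsOkamotoAttractor q K := by
  obtain ⟨r, hr, hL⟩ := exists_lipschitz_okamotoMap h1 h2
  let F : NonemptyCompacts (ℝ × ℝ) → NonemptyCompacts (ℝ × ℝ) := fun K =>
    ⟨⟨⋃ i : Fin 3, okamotoMap q i '' (K : Set (ℝ × ℝ)),
      isCompact_iUnion fun i => K.isCompact.image (hL i).continuous⟩,
      nonempty_iUnion.2 ⟨0, K.nonempty.image _⟩⟩
  have hF : ∀ K, (F K : Set (ℝ × ℝ)) = ⋃ i : Fin 3, okamotoMap q i '' (K : Set (ℝ × ℝ)) :=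
    fun _ => rfl
  have himg : ∀ (i : Fin 3) (A B : NonemptyCompacts (ℝ × ℝ)), ∀ x ∈ okamotoMap q i '' (A : Set _),
      ∃ y ∈ okamotoMap q i '' (B : Set (ℝ × ℝ)), edist x y ≤ r * edist A B := by
    rintro i A B _ ⟨a, ha, rfl⟩
    obtain ⟨b, hb, hab⟩ := B.isCompact.exists_infEDist_eq_edist B.nonempty a
    refine ⟨_, ⟨b, hb, rfl⟩, (hL i a b).trans ?_⟩
    gcongr
    rw [← hab]
    exact Metric.infEDist_le_hausdorffEDist_of_mem ha
  have hC : ContractingWith r F := by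
    refine ⟨hr, fun A B => ?_⟩
    change Metric.hausdorffEDist (F A : Set (ℝ × ℝ)) (F B) ≤ _
    rw [hF, hF]
    refine Metric.hausdorffEDist_iUnion_le.trans (iSup_le fun i => ?_)
    refine Metric.hausdorffEDist_le_of_mem_edist (himg i A B) fun x hx => ?_
    rw [edist_comm A B]
    exact himg i B A x hx
  obtain ⟨L, hfix⟩ : ∃ L : NonemptyCompacts (ℝ × ℝ), F L = L :=
    ⟨ContractingWith.fixedPoint F hC, hC.fixedPoint_isFixedPt⟩
  refine ⟨L, ⟨L.nonempty, L.isCompact, ?_⟩, ?_⟩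
  · rw [← hF, hfix]
  · rintro K ⟨hne, hc, hK⟩
    have : F ⟨⟨K, hc⟩, hne⟩ = ⟨⟨K, hc⟩, hne⟩ := SetLike.coe_injective hK.symm
    have h := hC.fixedPoint_unique' this hfix
    exact congrArg (fun L : NonemptyCompacts (ℝ × ℝ) => (L : Set (ℝ × ℝ))) h

/-- `K_q` is the unique nonempty compact set invariant under the Okamoto system. -/
theorem isOkamotoAttractor_okamotoGraph {q : ℝ} (h1 : 1 < q) (h2 : q < 2) :
    IsOkamotoAttractor q (okamotoGraph q) := by
  obtain ⟨K, hK, huniq⟩ := existsUnique_isOkamotoAttractor h1 h2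
  have : {K | IsOkamotoAttractor q K} = {K} := by
    ext L
    exact ⟨fun h => huniq L h, fun h => by rw [mem_singleton_iff.1 h]; exact hK⟩
  rw [okamotoGraph, this, sUnion_singleton]
  exact hK

/-! A point of the slice at height y is a ternary expansion whose digits record a way of inverting
the branches forever from y inside [0,1]. The images of `u_0` and `u_2` overlap in [1 - 1/q, 1/q],
which is exactly the image of `u_1`. Outside this overlap the branch is forced; inside it `u_0` and
`u_2` are both available. Lower bounds use these two branches only: an expansion steered by a bit
sequence reads one bit per visit to the overlap, and distinct sequences give distinct points when
visits recur. Recurrent visits give an uncountable slice (`not_countable_okamotoSlice_of_visits`),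
visits with bounded gaps give positive dimension (`dimH_okamotoSlice_pos_of_visits`).

Forced steps cannot jump over the overlap when q(1 - 1/q) ≤ 1/q, that is q² ≤ q + 1. Below the
golden ratio there is room to shrink the overlap, which keeps the orbit away from 0 and 1 and bounds
the gaps. At the golden ratio only orbits that can reach 0 or 1 may fail; such heights are countably
many, and inside (0,1) they pass through an end of the overlap, whose slice is infinite.

Above the golden ratio the heights 1/(q+1) and q/(q+1) form a 2-cycle that misses the overlap, so
their slices are single points. Yet the heights that never meet the overlap form a null set, by
Lebesgue density and self-similarity, and so do the heights that can reach them; all others return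
to the overlap forever. -/

open Filter Topology
open scoped ENNReal NNReal Pointwise

/-! ### The attractor, its orbits and its slices -/

/-- The attractor lies in the unit square. -/
theorem okamotoGraph_subset {q : ℝ} (h1 : 1 < q) (h2 : q < 2) {p : ℝ × ℝ}
    (hp : p ∈ okamotoGraph q) : p.1 ∈ Icc (0 : ℝ) 1 ∧ p.2 ∈ Icc (0 : ℝ) 1 := by
  obtain ⟨hne, hc, hK⟩ := isOkamotoAttractor_okamotoGraph h1 h2
  have ha1 : 1 / q < 1 := by rw [div_lt_one (by linarith)]; exact h1
  have ha2 : 1 / 2 < 1 / q := one_div_lt_one_div_of_lt (by linarith) h2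
  have hpre : ∀ p ∈ okamotoGraph q, ∃ i, ∃ p' ∈ okamotoGraph q, okamotoMap q i p' = p := by
    intro p hp
    rw [hK] at hp
    simpa using mem_iUnion.1 hp
  -- Let m be farthest from the centre. Its preimage is no farther, so the maximum D satisfies D ≤
  -- D/3 + 1/3, hence D ≤ 1/2. The heights use D ≤ D/q + (1 - 1/q)/2 in the same way.
  have hx : |p.1 - 1 / 2| ≤ 1 / 2 := by
    obtain ⟨m, hm, hmax⟩ := hc.exists_isMaxOn hne
      (f := fun p : ℝ × ℝ => |p.1 - 1 / 2|) (by fun_prop)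
    refine (hmax hp).trans ?_
    change |m.1 - 1 / 2| ≤ 1 / 2
    obtain ⟨i, p', hp', rfl⟩ := hpre m hm
    have hle : |p'.1 - 1 / 2| ≤ |okamotoV i p'.1 - 1 / 2| := hmax hp'
    change |okamotoV i p'.1 - 1 / 2| ≤ 1 / 2
    have hb := abs_le.1 (le_refl |p'.1 - 1 / 2|)
    have : |okamotoV i p'.1 - 1 / 2| ≤ |p'.1 - 1 / 2| / 3 + 1 / 3 := by
      rw [abs_le]
      fin_cases i <;> simp only [okamotoV] <;> norm_num <;> constructor <;> linarith
    linarith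
  have hy : |p.2 - 1 / 2| ≤ 1 / 2 := by
    obtain ⟨m, hm, hmax⟩ := hc.exists_isMaxOn hne
      (f := fun p : ℝ × ℝ => |p.2 - 1 / 2|) (by fun_prop)
    refine (hmax hp).trans ?_
    change |m.2 - 1 / 2| ≤ 1 / 2
    obtain ⟨i, p', hp', rfl⟩ := hpre m hm
    have hle : |p'.2 - 1 / 2| ≤ |okamotoU q i p'.2 - 1 / 2| := hmax hp'
    change |okamotoU q i p'.2 - 1 / 2| ≤ 1 / 2
    have hb := abs_le.1 (le_refl |p'.2 - 1 / 2|)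
    have : |okamotoU q i p'.2 - 1 / 2| ≤ 1 / q * |p'.2 - 1 / 2| + (1 - 1 / q) / 2 := by
      have h3 : 0 ≤ 1 / q * (|p'.2 - 1 / 2| - (p'.2 - 1 / 2)) := by
        apply mul_nonneg <;> linarith
      have h4 : 0 ≤ 1 / q * (|p'.2 - 1 / 2| + (p'.2 - 1 / 2)) := by
        apply mul_nonneg <;> linarith
      have h5 : 0 ≤ (1 - 1 / q) * |p'.2 - 1 / 2| := by
        apply mul_nonneg <;> linarith [abs_nonneg (p'.2 - 1 / 2)]
      have h6 : 0 ≤ (2 * (1 / q) - 1) * (|p'.2 - 1 / 2| - (p'.2 - 1 / 2)) := by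
        apply mul_nonneg <;> linarith
      have h7 : 0 ≤ (2 * (1 / q) - 1) * (|p'.2 - 1 / 2| + (p'.2 - 1 / 2)) := by
        apply mul_nonneg <;> linarith
      rw [abs_le]
      fin_cases i <;> simp [okamotoU, div_eq_mul_inv] at * <;> constructor <;> linarith
    nlinarith
  rw [abs_le] at hx hy
  refine ⟨⟨?_, ?_⟩, ⟨?_, ?_⟩⟩ <;> linarith

theorem mem_okamotoSlice_iff {q : ℝ} (h1 : 1 < q) (h2 : q < 2) {x y : ℝ} :
    x ∈ okamotoSlice q y ↔ (x, y) ∈ okamotoGraph q :=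
  ⟨fun h => h.2, fun h => ⟨(okamotoGraph_subset h1 h2 h).1, h⟩⟩

/-- A bounded orbit under the inverse branches starts in the attractor. -/
theorem mem_okamotoGraph_of_orbit {q : ℝ} (h1 : 1 < q) (h2 : q < 2) (p : ℕ → ℝ × ℝ)
    (hp : ∀ n, p n ∈ Icc (0 : ℝ) 1 ×ˢ Icc (0 : ℝ) 1)
    (h : ∀ n, ∃ i, p n = okamotoMap q i (p (n + 1))) : p 0 ∈ okamotoGraph q := by
  obtain ⟨hne, hc, hK⟩ := isOkamotoAttractor_okamotoGraph h1 h2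
  obtain ⟨r, hr, hL⟩ := exists_lipschitz_okamotoMap h1 h2
  obtain ⟨k, hk⟩ := hne
  have hinv : ∀ i, ∀ p ∈ okamotoGraph q, okamotoMap q i p ∈ okamotoGraph q := fun i p hp => by
    rw [hK]; exact mem_iUnion.2 ⟨i, p, hp, rfl⟩
  have hstep : ∀ n, Metric.infDist (p n) (okamotoGraph q)
      ≤ r * Metric.infDist (p (n + 1)) (okamotoGraph q) := by
    intro n
    obtain ⟨i, hi⟩ := h n
    obtain ⟨b, hb, hab⟩ := hc.exists_infDist_eq_dist ⟨k, hk⟩ (p (n + 1))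
    rw [hab, hi]
    exact (Metric.infDist_le_dist_of_mem (hinv i b hb)).trans ((hL i).dist_le_mul _ _)
  have hbd : ∀ n, Metric.infDist (p n) (okamotoGraph q) ≤ 1 := by
    intro n
    refine (Metric.infDist_le_dist_of_mem hk).trans ?_
    obtain ⟨hk1, hk2⟩ := okamotoGraph_subset h1 h2 hk
    rw [Prod.dist_eq]
    exact max_le (by simpa using Real.dist_le_of_mem_Icc (hp n).1 hk1)
      (by simpa using Real.dist_le_of_mem_Icc (hp n).2 hk2)
  have hpow : ∀ n m, Metric.infDist (p m) (okamotoGraph q) ≤ (r : ℝ) ^ n := by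
    intro n
    induction n with
    | zero => intro m; simpa using hbd m
    | succ n ih =>
      intro m
      refine (hstep m).trans ?_
      rw [pow_succ']
      gcongr
      exact ih _
  have hzero : Metric.infDist (p 0) (okamotoGraph q) ≤ 0 :=
    ge_of_tendsto' (tendsto_pow_atTop_nhds_zero_of_lt_one r.2 (by exact_mod_cast hr))
      fun n => hpow n 0
  exact (hc.isClosed.mem_iff_infDist_zero ⟨k, hk⟩).2 (le_antisymm hzero Metric.infDist_nonneg)

/-- Slices decompose along the three branches. -/
theorem mem_okamotoSlice_iff_exists {q : ℝ} (h1 : 1 < q) (h2 : q < 2) {x y : ℝ} :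
    x ∈ okamotoSlice q y ↔ ∃ i, ∃ y' ∈ Icc (0 : ℝ) 1, ∃ x' ∈ okamotoSlice q y',
      x = okamotoV i x' ∧ y = okamotoU q i y' := by
  have hK := (isOkamotoAttractor_okamotoGraph h1 h2).2.2
  rw [mem_okamotoSlice_iff h1 h2]
  constructor
  · intro h
    rw [hK] at h
    obtain ⟨i, ⟨x', y'⟩, hp, he⟩ := mem_iUnion.1 h
    obtain ⟨rfl, rfl⟩ := Prod.mk.inj he
    obtain ⟨hx, hy⟩ := okamotoGraph_subset h1 h2 hp
    exact ⟨i, y', hy, x', ⟨hx, hp⟩, rfl, rfl⟩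
  · rintro ⟨i, y', -, x', ⟨-, hp⟩, rfl, rfl⟩
    rw [hK]
    exact mem_iUnion.2 ⟨i, (x', y'), hp, rfl⟩

/-- A bounded set whose distance to `c` shrinks under passing to preimages is contained in
`{c}`. -/
theorem subset_singleton_of_contracting {S : Set ℝ} {c r : ℝ} (hS : S ⊆ Icc 0 1) (hr0 : 0 ≤ r)
    (hr1 : r < 1) (h : ∀ x ∈ S, ∃ x' ∈ S, |x - c| ≤ r * |x' - c|) : S ⊆ {c} := by
  have hpow : ∀ n : ℕ, ∀ x ∈ S, |x - c| ≤ r ^ n * (1 + |c|) := by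
    intro n
    induction n with
    | zero =>
      intro x hx
      have : |x| ≤ 1 := abs_le.2 ⟨by linarith [(hS hx).1], (hS hx).2⟩
      simpa using (abs_sub x c).trans (by linarith)
    | succ n ih =>
      intro x hx
      obtain ⟨x', hx', hle⟩ := h x hx
      refine hle.trans ?_
      rw [pow_succ', mul_assoc]
      gcongr
      exact ih x' hx'
  intro x hx
  have ht : Tendsto (fun n : ℕ => r ^ n * (1 + |c|)) atTop (𝓝 (0 * (1 + |c|))) :=
    (tendsto_pow_atTop_nhds_zero_of_lt_one hr0 hr1).mul_const _
  rw [zero_mul] at ht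
  have := ge_of_tendsto' ht fun n => hpow n x hx
  exact sub_eq_zero.1 (abs_nonpos_iff.1 this)

/-! ### The two orientation-preserving branches -/

/-- The orientation-preserving branches `u_0` (`false`) and `u_2` (`true`). -/
noncomputable def outerBranch (q : ℝ) (b : Bool) (z : ℝ) : ℝ :=
  cond b (z / q + (1 - 1 / q)) (z / q)

/-- The inverses of the orientation-preserving branches. -/
noncomputable def outerInverse (q : ℝ) (b : Bool) (y : ℝ) : ℝ :=
  cond b (q * y - (q - 1)) (q * y)

/-- The ternary digit of an orientation-preserving branch. -/
def outerDigit (b : Bool) : Fin 3 := cond b 2 0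

theorem okamotoU_outerDigit (q : ℝ) (b : Bool) (z : ℝ) :
    okamotoU q (outerDigit b) z = outerBranch q b z := by
  cases b <;> simp [okamotoU, outerDigit, outerBranch]

theorem outerBranch_outerInverse {q : ℝ} (hq : 0 < q) (b : Bool) (y : ℝ) :
    outerBranch q b (outerInverse q b y) = y := by
  cases b <;> simp [outerBranch, outerInverse] <;> field_simp
  ring

theorem outerInverse_outerBranch {q : ℝ} (hq : 0 < q) (b : Bool) (y : ℝ) :
    outerInverse q b (outerBranch q b y) = y := by
  cases b <;> simp [outerBranch, outerInverse] <;> field_simp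
  ring

theorem outerBranch_mem_Icc {q : ℝ} (h1 : 1 < q) (b : Bool) {z : ℝ} (hz : z ∈ Icc (0 : ℝ) 1) :
    outerBranch q b z ∈ Icc (0 : ℝ) 1 := by
  have hq : 0 < q := by linarith
  have h3 : z / q ≤ 1 / q := by gcongr; exact hz.2
  have h4 : 0 ≤ z / q := div_nonneg hz.1 hq.le
  have h5 : 1 / q < 1 := by rw [div_lt_one hq]; exact h1
  cases b <;> simp only [outerBranch, cond_true, cond_false] <;> constructor <;> linarith

/-- `z` is obtained from `y` by inverting one orientation-preserving branch. -/
def OuterStep (q y z : ℝ) : Prop :=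
  z ∈ Icc (0 : ℝ) 1 ∧ ∃ b, y = outerBranch q b z

/-- `z` is reached from `y` by inverting finitely many orientation-preserving branches. -/
def OuterReach (q : ℝ) : ℝ → ℝ → Prop := Relation.ReflTransGen (OuterStep q)

theorem outerStep_outerInverse {q y : ℝ} (h1 : 1 < q) {b : Bool}
    (h : outerInverse q b y ∈ Icc (0 : ℝ) 1) : OuterStep q y (outerInverse q b y) :=
  ⟨h, b, (outerBranch_outerInverse (by linarith) b y).symm⟩

theorem outerInverse_false_mem {q y : ℝ} (h1 : 1 < q) (h0 : 0 ≤ y) (hy : y ≤ 1 / q) :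
    outerInverse q false y ∈ Icc (0 : ℝ) 1 := by
  rw [le_div_iff₀ (by linarith)] at hy
  simp only [outerInverse, cond_false]
  constructor <;> nlinarith

theorem outerInverse_true_mem {q y : ℝ} (h1 : 1 < q) (h0 : 1 - 1 / q ≤ y) (hy : y ≤ 1) :
    outerInverse q true y ∈ Icc (0 : ℝ) 1 := by
  have h : q * (1 / q) = 1 := by field_simp
  simp only [outerInverse, cond_true]
  constructor <;> nlinarith

/-- Slices pull back along steps. -/
theorem OuterStep.image_subset {q y z : ℝ} (h1 : 1 < q) (h2 : q < 2) (h : OuterStep q y z) :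
    ∃ i, okamotoV i '' okamotoSlice q z ⊆ okamotoSlice q y := by
  obtain ⟨hz, b, rfl⟩ := h
  refine ⟨outerDigit b, ?_⟩
  rintro _ ⟨x, hx, rfl⟩
  exact (mem_okamotoSlice_iff_exists h1 h2).2
    ⟨outerDigit b, z, hz, x, hx, rfl, (okamotoU_outerDigit q b z).symm⟩

theorem okamotoV_injective (i : Fin 3) : Function.Injective (okamotoV i) := by
  intro x y h
  simp only [okamotoV] at h
  linarith

theorem OuterReach.infinite_okamotoSlice {q y z : ℝ} (h1 : 1 < q) (h2 : q < 2)
    (h : OuterReach q y z) (hz : (okamotoSlice q z).Infinite) : (okamotoSlice q y).Infinite := by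
  induction h using Relation.ReflTransGen.head_induction_on with
  | refl => exact hz
  | head hs _ ih =>
    obtain ⟨i, hi⟩ := hs.image_subset h1 h2
    exact (ih.image (okamotoV_injective i).injOn).mono hi

/-- Below the overlap interval only the branch `u_0` is available. -/
theorem okamotoSlice_eq_image_zero {q y : ℝ} (h1 : 1 < q) (h2 : q < 2) (h0 : 0 ≤ y)
    (hy : y < 1 - 1 / q) : okamotoSlice q y = okamotoV 0 '' okamotoSlice q (q * y) := by
  have hq : 0 < q := by linarith
  have ha2 : 1 / 2 < 1 / q := one_div_lt_one_div_of_lt (by linarith) h2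
  have h5 : 1 / q < 1 := by rw [div_lt_one hq]; exact h1
  ext x
  rw [mem_okamotoSlice_iff_exists h1 h2]
  constructor
  · rintro ⟨i, y', hy', x', hx', rfl, hu⟩
    -- These bounds put the images of `u_2` and `u_1` at or above 1 - 1/q, which leaves only `u_0`.
    have h6 : 0 ≤ y' / q := div_nonneg hy'.1 hq.le
    have h7 : 0 ≤ (2 / q - 1) * (1 - y') := by
      have : 2 / q = 2 * (1 / q) := by ring
      apply mul_nonneg <;> linarith [hy'.2]
    fin_cases i <;> simp [okamotoU] at hu <;> simp at *
    · refine ⟨x', ?_, rfl⟩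
      rw [hu]; convert hx' using 2; field_simp
    · linarith
    · linarith
  · rintro ⟨x', hx', rfl⟩
    refine ⟨0, q * y, outerInverse_false_mem h1 h0 (by linarith), x', hx', rfl, ?_⟩
    simp [okamotoU]; field_simp

/-- Above the overlap interval only the branch `u_2` is available. -/
theorem okamotoSlice_eq_image_two {q y : ℝ} (h1 : 1 < q) (h2 : q < 2) (h0 : 1 / q < y)
    (hy : y ≤ 1) : okamotoSlice q y = okamotoV 2 '' okamotoSlice q (q * y - (q - 1)) := by
  have hq : 0 < q := by linarith
  have ha2 : 1 / 2 < 1 / q := one_div_lt_one_div_of_lt (by linarith) h2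
  have h5 : 1 / q < 1 := by rw [div_lt_one hq]; exact h1
  ext x
  rw [mem_okamotoSlice_iff_exists h1 h2]
  constructor
  · rintro ⟨i, y', hy', x', hx', rfl, hu⟩
    have h6 : y' / q ≤ 1 / q := by gcongr; exact hy'.2
    have h7 : 0 ≤ (2 / q - 1) * y' := by
      have : 2 / q = 2 * (1 / q) := by ring
      apply mul_nonneg <;> linarith [hy'.1]
    have h8 : 2 / q = 2 * (1 / q) := by ring
    fin_cases i <;> simp [okamotoU] at hu <;> simp at *
    · linarith
    · linarith
    · refine ⟨x', ?_, rfl⟩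
      rw [hu]; convert hx' using 2; field_simp; ring
  · rintro ⟨x', hx', rfl⟩
    refine ⟨2, q * y - (q - 1), outerInverse_true_mem h1 (by linarith) hy, x', hx', rfl, ?_⟩
    simp [okamotoU]; field_simp; ring

/-! ### Expansions steered by a bit sequence -/

/-- The branch chosen at a state `(y, j)`: forced below `lo` and above `hi`, and given by the
`j`-th bit in between. -/
noncomputable def steerBit (lo hi : ℝ) (b : ℕ → Bool) (s : ℝ × ℕ) : Bool :=
  if s.1 < lo then false else if hi < s.1 then true else b s.2

/-- One step of the expansion steered by `b`; the counter records the number of bits read. -/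
noncomputable def steerNext (q lo hi : ℝ) (b : ℕ → Bool) (s : ℝ × ℕ) : ℝ × ℕ :=
  (outerInverse q (steerBit lo hi b s) s.1, if lo ≤ s.1 ∧ s.1 ≤ hi then s.2 + 1 else s.2)

/-- The state after `n` steps, starting at height `y`. -/
noncomputable def steerState (q lo hi y : ℝ) (b : ℕ → Bool) (n : ℕ) : ℝ × ℕ :=
  (steerNext q lo hi b)^[n] (y, 0)

/-- The ternary digits produced along the steered expansion. -/
noncomputable def steerDigit (q lo hi y : ℝ) (b : ℕ → Bool) (n : ℕ) : Fin 3 :=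
  outerDigit (steerBit lo hi b (steerState q lo hi y b n))

/-- The point of the slice produced by the steered expansion. -/
noncomputable def steerPoint (q lo hi y : ℝ) (b : ℕ → Bool) : ℝ :=
  Real.ofDigits (steerDigit q lo hi y b)

/-- `W` is stable under every steered step. -/
def SteerInvariant (q lo hi : ℝ) (W : Set ℝ) : Prop :=
  W ⊆ Icc 0 1 ∧ ∀ y ∈ W, (y < lo → outerInverse q false y ∈ W) ∧
    (hi < y → outerInverse q true y ∈ W) ∧ (lo ≤ y → y ≤ hi → ∀ b, outerInverse q b y ∈ W)

theorem steerState_succ (q lo hi y : ℝ) (b : ℕ → Bool) (n : ℕ) :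
    steerState q lo hi y b (n + 1) = steerNext q lo hi b (steerState q lo hi y b n) :=
  Function.iterate_succ_apply' _ _ _

theorem steerState_add (q lo hi y : ℝ) (b : ℕ → Bool) (n m : ℕ) :
    steerState q lo hi y b (m + n) = (steerNext q lo hi b)^[m] (steerState q lo hi y b n) :=
  Function.iterate_add_apply _ _ _ _

theorem SteerInvariant.next_mem {q lo hi : ℝ} {W : Set ℝ} (hW : SteerInvariant q lo hi W)
    (b : ℕ → Bool) {s : ℝ × ℕ} (hs : s.1 ∈ W) : (steerNext q lo hi b s).1 ∈ W := by
  obtain ⟨h1, h2, h3⟩ := hW.2 s.1 hs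
  unfold steerNext steerBit
  dsimp only
  split_ifs with hlo hhi
  · exact h1 hlo
  · exact h2 hhi
  · exact h3 (not_lt.1 hlo) (not_lt.1 hhi) _

theorem SteerInvariant.iterate_mem {q lo hi : ℝ} {W : Set ℝ} (hW : SteerInvariant q lo hi W)
    (b : ℕ → Bool) {s : ℝ × ℕ} (hs : s.1 ∈ W) (n : ℕ) : ((steerNext q lo hi b)^[n] s).1 ∈ W := by
  induction n with
  | zero => exact hs
  | succ n ih =>
    rw [Function.iterate_succ_apply']
    exact hW.next_mem b ih

theorem le_steerNext_snd (q lo hi : ℝ) (b : ℕ → Bool) (s : ℝ × ℕ) :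
    s.2 ≤ (steerNext q lo hi b s).2 := by
  unfold steerNext
  dsimp only
  split_ifs <;> omega

theorem monotone_steer_counter (q lo hi : ℝ) (b : ℕ → Bool) (s : ℝ × ℕ) :
    Monotone fun n => ((steerNext q lo hi b)^[n] s).2 := by
  refine monotone_nat_of_le_succ fun n => ?_
  rw [Function.iterate_succ_apply']
  exact le_steerNext_snd _ _ _ _ _

/-- Visiting the interval `[lo, hi]` reads a bit. -/
theorem lt_steer_counter_of_visit {q lo hi : ℝ} {b : ℕ → Bool} {s : ℝ × ℕ} {n N : ℕ} (hn : n < N)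
    (hv : ((steerNext q lo hi b)^[n] s).1 ∈ Icc lo hi) :
    s.2 < ((steerNext q lo hi b)^[N] s).2 := by
  have h1 : s.2 ≤ ((steerNext q lo hi b)^[n] s).2 :=
    monotone_steer_counter q lo hi b s (Nat.zero_le n)
  have h2 : ((steerNext q lo hi b)^[n + 1] s).2 = ((steerNext q lo hi b)^[n] s).2 + 1 := by
    rw [Function.iterate_succ_apply']
    exact if_pos hv
  have h3 : ((steerNext q lo hi b)^[n + 1] s).2 ≤ ((steerNext q lo hi b)^[N] s).2 :=
    monotone_steer_counter q lo hi b s hn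
  omega

/-- Prepending a ternary digit is the action of a branch on the first coordinate. -/
theorem ofDigits_three_eq (d : ℕ → Fin 3) :
    Real.ofDigits d = okamotoV (d 0) (Real.ofDigits fun i => d (i + 1)) := by
  rw [Real.ofDigits_eq_sum_add_ofDigits d 1]
  simp [Real.ofDigitsTerm, okamotoV]
  ring

/-- The tails of the digit sequence, paired with the successive heights, form a bounded orbit under
the inverse branches. -/
theorem steerPoint_mem_okamotoSlice {q lo hi y : ℝ} {W : Set ℝ} (h1 : 1 < q) (h2 : q < 2)
    (hW : SteerInvariant q lo hi W) (hy : y ∈ W) (b : ℕ → Bool) :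
    steerPoint q lo hi y b ∈ okamotoSlice q y := by
  rw [mem_okamotoSlice_iff h1 h2]
  refine mem_okamotoGraph_of_orbit h1 h2 (fun n =>
    (Real.ofDigits fun i => steerDigit q lo hi y b (i + n), (steerState q lo hi y b n).1))
    (fun n => ⟨⟨Real.ofDigits_nonneg _, Real.ofDigits_le_one _⟩,
      hW.1 (hW.iterate_mem b hy n)⟩) fun n => ⟨steerDigit q lo hi y b n, Prod.ext ?_ ?_⟩
  · dsimp only [okamotoMap]
    rw [ofDigits_three_eq]
    simp only [zero_add]
    congr 2
    funext i
    congr 1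
    omega
  · dsimp only [okamotoMap]
    rw [steerDigit, okamotoU_outerDigit, steerState_succ]
    exact (outerBranch_outerInverse (by linarith) _ _).symm

/-- Close points of the Cantor set share their first ternary digits. -/
theorem ofDigits_outerDigit_eq_of_abs_lt {d d' : ℕ → Bool} {M : ℕ}
    (h : |Real.ofDigits (fun n => outerDigit (d n)) - Real.ofDigits (fun n => outerDigit (d' n))|
      < ((3 : ℝ) ^ M)⁻¹) : ∀ n < M, d n = d' n := by
  induction M generalizing d d' with
  | zero => intro n hn; omega
  | succ M ih =>
    rw [ofDigits_three_eq, ofDigits_three_eq (fun n => outerDigit (d' n))] at h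
    have hX := Real.ofDigits_nonneg (fun n => outerDigit (d (n + 1)))
    have hX' := Real.ofDigits_le_one (fun n => outerDigit (d (n + 1)))
    have hY := Real.ofDigits_nonneg (fun n => outerDigit (d' (n + 1)))
    have hY' := Real.ofDigits_le_one (fun n => outerDigit (d' (n + 1)))
    have hle : ((3 : ℝ) ^ (M + 1))⁻¹ ≤ 1 / 3 := by
      rw [pow_succ, mul_inv, one_div]
      exact mul_le_of_le_one_left (by norm_num) (inv_le_one_of_one_le₀ (one_le_pow₀ (by norm_num)))
    -- Only the digits 0 and 2 occur, so different first digits put the points in [0,1/3] and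
    -- [2/3,1], at distance at least 1/3.
    have h0 : d 0 = d' 0 := by
      obtain ⟨h3, h4⟩ := abs_lt.1 (h.trans_le hle)
      cases hd : d 0 <;> cases hd' : d' 0 <;>
        simp [okamotoV, outerDigit, hd, hd'] at h3 h4 hX hX' hY hY' ⊢ <;> linarith
    have hrec : |Real.ofDigits (fun n => outerDigit (d (n + 1))) -
        Real.ofDigits (fun n => outerDigit (d' (n + 1)))| < ((3 : ℝ) ^ M)⁻¹ := by
      rw [h0] at h
      simp only [okamotoV] at h
      rw [← sub_div, add_sub_add_right_eq_sub, abs_div, abs_of_pos (by norm_num : (0 : ℝ) < 3),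
        div_lt_iff₀ (by norm_num), pow_succ, mul_inv, mul_assoc] at h
      simpa using h
    intro n hn
    cases n with
    | zero => exact h0
    | succ n => exact ih hrec n (by omega)

/-- If two steered expansions produce the same first digits, they have read the same bits. -/
theorem steerState_eq_of_steerBit_eq {q lo hi y : ℝ} {b b' : ℕ → Bool} {M : ℕ}
    (h : ∀ n < M, steerBit lo hi b (steerState q lo hi y b n) =
      steerBit lo hi b' (steerState q lo hi y b' n)) :
    steerState q lo hi y b M = steerState q lo hi y b' M ∧
      ∀ j < (steerState q lo hi y b M).2, b j = b' j := by
  induction M with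
  | zero => exact ⟨rfl, fun j hj => absurd hj (Nat.not_lt_zero j)⟩
  | succ M ih =>
    obtain ⟨hs, hb⟩ := ih fun n hn => h n (by omega)
    have hM := h M (by omega)
    rw [← hs] at hM
    rw [steerState_succ, steerState_succ, ← hs]
    refine ⟨?_, ?_⟩
    · unfold steerNext
      rw [hM]
    · intro j hj
      unfold steerNext at hj
      dsimp only at hj
      split_ifs at hj with hv
      · rcases Nat.lt_succ_iff_lt_or_eq.1 hj with hj | rfl
        · exact hb j hj
        · simpa [steerBit, not_lt.2 hv.1, not_lt.2 hv.2] using hM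
      · exact hb j hj

/-- Quantitative injectivity: a bit read within M steps is determined by the point up to an error
below 3^(-M). This gives both injectivity and the Hölder bound for the dimension. -/
theorem eq_of_abs_steerPoint_sub_lt {q lo hi y : ℝ} {b b' : ℕ → Bool} {M j : ℕ}
    (hj : j < (steerState q lo hi y b M).2)
    (h : |steerPoint q lo hi y b - steerPoint q lo hi y b'| < ((3 : ℝ) ^ M)⁻¹) : b j = b' j :=
  (steerState_eq_of_steerBit_eq (ofDigits_outerDigit_eq_of_abs_lt h)).2 j hj

theorem steerPoint_injective {q lo hi y : ℝ}
    (h : ∀ b j, ∃ M, j < (steerState q lo hi y b M).2) :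
    Function.Injective (steerPoint q lo hi y) := by
  intro b b' he
  funext j
  obtain ⟨M, hM⟩ := h b j
  refine eq_of_abs_steerPoint_sub_lt hM ?_
  rw [he, sub_self, abs_zero]
  positivity

/-! ### From visits to the size of the slice -/

/-- If the interval `[lo, hi]` is visited again and again, the slice is uncountable. -/
theorem not_countable_okamotoSlice_of_visits {q lo hi y : ℝ} {W : Set ℝ} (h1 : 1 < q)
    (h2 : q < 2) (hW : SteerInvariant q lo hi W) (hy : y ∈ W)
    (hv : ∀ b, ∀ s : ℝ × ℕ, s.1 ∈ W → ∃ n, ((steerNext q lo hi b)^[n] s).1 ∈ Icc lo hi) :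
    ¬ (okamotoSlice q y).Countable := by
  intro hc
  have hun : ∀ b j, ∃ M, j < (steerState q lo hi y b M).2 := by
    intro b j
    have key : ∀ k, ∃ M, k ≤ (steerState q lo hi y b M).2 := by
      intro k
      induction k with
      | zero => exact ⟨0, Nat.zero_le _⟩
      | succ k ih =>
        obtain ⟨M, hM⟩ := ih
        obtain ⟨n, hn⟩ := hv b _ (hW.iterate_mem b (s := (y, 0)) hy M)
        refine ⟨n + 1 + M, ?_⟩
        rw [steerState_add]
        exact (Nat.succ_le_succ hM).trans (lt_steer_counter_of_visit (Nat.lt_succ_self n) hn)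
    exact key (j + 1)
  have hr : (range (steerPoint q lo hi y)).Countable :=
    hc.mono (range_subset_iff.2 (steerPoint_mem_okamotoSlice h1 h2 hW hy))
  rw [← image_univ] at hr
  have hcu := countable_of_injective_of_countable_image (steerPoint_injective hun).injOn hr
  have : Uncountable (ℕ → Bool) := by
    rw [← Cardinal.aleph0_lt_mk_iff]
    simp [Cardinal.aleph0_lt_continuum]
  exact not_countable_univ hcu

/-- If the interval `[lo, hi]` is visited with bounded gaps, the slice has positive dimension. -/
theorem dimH_okamotoSlice_pos_of_visits {q lo hi y : ℝ} {W : Set ℝ} {N : ℕ} (h1 : 1 < q)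
    (h2 : q < 2) (hW : SteerInvariant q lo hi W) (hy : y ∈ W)
    (hv : ∀ b, ∀ s : ℝ × ℕ, s.1 ∈ W → ∃ n < N, ((steerNext q lo hi b)^[n] s).1 ∈ Icc lo hi) :
    0 < dimH (okamotoSlice q y) := by
  have hN : 0 < N := by
    obtain ⟨n, hn, -⟩ := hv (fun _ => true) (y, 0) hy
    omega
  have hcount : ∀ b k, k ≤ (steerState q lo hi y b (N * k)).2 := by
    intro b k
    induction k with
    | zero => exact Nat.zero_le _
    | succ k ih =>
      obtain ⟨n, hn, hn'⟩ := hv b _ (hW.iterate_mem b (s := (y, 0)) hy (N * k))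
      rw [Nat.mul_succ, add_comm (N * k), steerState_add]
      exact (Nat.succ_le_succ ih).trans (lt_steer_counter_of_visit hn hn')
  have hinj : Function.Injective (steerPoint q lo hi y) :=
    steerPoint_injective fun b j => ⟨N * (j + 1), hcount b (j + 1)⟩
  -- Decoding a point to the binary number of its bits maps the steered points onto [0,1]; a Hölder
  -- bound then forces positive dimension. The exponent `r` is chosen so that 3^(rN) = 2.
  let value : (ℕ → Bool) → ℝ := fun b => Real.ofDigits fun i => finTwoEquiv.symm (b i)
  let f : ℝ → ℝ := fun x => value (Function.invFun (steerPoint q lo hi y) x)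
  have hf : ∀ b, f (steerPoint q lo hi y b) = value b := fun b =>
    congrArg value (Function.leftInverse_invFun hinj b)
  set r : ℝ≥0 := ⟨Real.log 2 / (N * Real.log 3), by positivity⟩ with hr
  have hrpos : 0 < r := by
    rw [← NNReal.coe_pos]
    change 0 < Real.log 2 / (N * Real.log 3)
    positivity
  have hpow : ∀ j : ℕ, (((3 : ℝ) ^ (N * j))⁻¹) ^ (r : ℝ) = ((2 : ℝ) ^ j)⁻¹ := by
    intro j
    have : (3 : ℝ) ^ (r * N : ℝ) = 2 := by
      rw [Real.rpow_def_of_pos (by norm_num)]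
      change Real.exp (Real.log 3 * (Real.log 2 / (N * Real.log 3) * N)) = 2
      have h3 : Real.log 3 ≠ 0 := (Real.log_pos (by norm_num)).ne'
      have hN' : (N : ℝ) ≠ 0 := by positivity
      rw [show Real.log 3 * (Real.log 2 / (N * Real.log 3) * N) = Real.log 2 by field_simp,
        Real.exp_log (by norm_num)]
    rw [Real.inv_rpow (by positivity), ← Real.rpow_natCast, ← Real.rpow_mul (by norm_num)]
    push_cast
    rw [show (N : ℝ) * j * r = r * N * j by ring, Real.rpow_mul (by norm_num), this,
      Real.rpow_natCast]
  have hholder : HolderOnWith 2 r f (range (steerPoint q lo hi y)) := by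
    rintro _ ⟨b, rfl⟩ _ ⟨b', rfl⟩
    rw [hf, hf]
    by_cases hbb : b = b'
    · rw [hbb, edist_self]
      exact zero_le
    obtain ⟨j, hj, hmin⟩ : ∃ j, b j ≠ b' j ∧ ∀ i < j, b i = b' i := by
      have hex : ∃ j, b j ≠ b' j := by
        by_contra! hcon
        exact hbb (funext hcon)
      exact ⟨Nat.find hex, Nat.find_spec hex, fun i hi => not_not.1 (Nat.find_min hex hi)⟩
    -- Bit j has been read by step N(j+1), whereas the values agree only up to 2^(-j); this shift by
    -- one is the Hölder constant 2.
    have hlow : ((3 : ℝ) ^ (N * (j + 1)))⁻¹ ≤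
        dist (steerPoint q lo hi y b) (steerPoint q lo hi y b') := by
      by_contra! hcon
      exact hj (eq_of_abs_steerPoint_sub_lt (hcount b (j + 1)) hcon)
    have hup : dist (value b) (value b') ≤ ((2 : ℝ) ^ j)⁻¹ := by
      have := Real.abs_ofDigits_sub_ofDigits_le (x := fun i => finTwoEquiv.symm (b i))
        (y := fun i => finTwoEquiv.symm (b' i)) (n := j) (fun i hi => by rw [hmin i hi])
      simpa [Real.dist_eq] using this
    have hreal : dist (value b) (value b') ≤
        2 * dist (steerPoint q lo hi y b) (steerPoint q lo hi y b') ^ (r : ℝ) := by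
      refine hup.trans ?_
      have := Real.rpow_le_rpow (by positivity) hlow r.coe_nonneg
      have h3 := hpow (j + 1)
      rw [h3, pow_succ, mul_inv] at this
      linarith
    rw [edist_dist, edist_dist, ENNReal.ofReal_rpow_of_nonneg dist_nonneg r.coe_nonneg,
      show ((2 : ℝ≥0) : ℝ≥0∞) = ENNReal.ofReal 2 by simp, ← ENNReal.ofReal_mul (by norm_num)]
    exact ENNReal.ofReal_le_ofReal hreal
  have himg : Icc (0 : ℝ) 1 ⊆ f '' range (steerPoint q lo hi y) := by
    intro t ht
    obtain ⟨d, -, rfl⟩ := Real.ofDigits_SurjOn (b := 2) (by norm_num) ht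
    refine ⟨_, ⟨fun i => finTwoEquiv (d i), rfl⟩, ?_⟩
    rw [hf]
    simp [value]
  have hone : (1 : ℝ≥0∞) ≤ dimH (range (steerPoint q lo hi y)) / r := by
    have hI : dimH (Icc (0 : ℝ) 1) = 1 := by
      rw [Real.dimH_of_nonempty_interior (by simp)]
      simp
    rw [← hI]
    exact (dimH_mono himg).trans (hholder.dimH_image_le hrpos)
  refine lt_of_lt_of_le ?_
    (dimH_mono (range_subset_iff.2 (steerPoint_mem_okamotoSlice h1 h2 hW hy)))
  rw [pos_iff_ne_zero]
  intro h0
  rw [h0, ENNReal.zero_div] at hone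
  exact absurd hone (by norm_num)

theorem steerNext_fst_of_lt {q lo hi : ℝ} {b : ℕ → Bool} {s : ℝ × ℕ} (h : s.1 < lo) :
    (steerNext q lo hi b s).1 = q * s.1 := by
  simp [steerNext, steerBit, h, outerInverse]

theorem steerNext_fst_of_gt {q lo hi : ℝ} {b : ℕ → Bool} {s : ℝ × ℕ} (h : ¬ s.1 < lo)
    (h' : hi < s.1) : (steerNext q lo hi b s).1 = q * s.1 - (q - 1) := by
  simp [steerNext, steerBit, h, h', outerInverse]

/-- If the forced branches cannot jump over `[lo, hi]`, then the interval is visited in bounded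
time from any point that is bounded away from the endpoints. -/
theorem exists_visit_le {q lo hi δ : ℝ} {M : ℕ} (hlo : lo ≤ 1) (hhi : 0 ≤ hi)
    (hlohi : lo ≤ hi) (h : q * lo ≤ hi) (h' : lo ≤ q * hi - (q - 1)) (h1 : 1 < q)
    (hM : 1 < q ^ M * δ) (b : ℕ → Bool) {s : ℝ × ℕ} (hs : s.1 ∈ Icc δ (1 - δ)) :
    ∃ n < M + 1, ((steerNext q lo hi b)^[n] s).1 ∈ Icc lo hi := by
  by_contra! hcon
  have hq : 0 < q := by linarith
  have hqM : 0 < q ^ M := by positivity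
  rcases lt_or_ge s.1 lo with hslo | hslo
  -- Since q·lo ≤ hi, an orbit that starts below and misses the interval stays below it while
  -- growing by the factor q; after M steps it exceeds 1. The case above is the mirror image in 1 -
  -- y.
  · have key : ∀ n < M + 1, ((steerNext q lo hi b)^[n] s).1 = q ^ n * s.1 ∧
        ((steerNext q lo hi b)^[n] s).1 < lo := by
      intro n
      induction n with
      | zero => intro _; simpa using hslo
      | succ n ih =>
        intro hn
        obtain ⟨he, hl⟩ := ih (by omega)
        have hnot := hcon (n + 1) hn
        rw [Function.iterate_succ_apply', steerNext_fst_of_lt hl] at hnot ⊢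
        refine ⟨by rw [he]; ring, ?_⟩
        by_contra! hge
        exact hnot ⟨hge, by nlinarith⟩
    obtain ⟨he, hl⟩ := key M (by omega)
    have := mul_le_mul_of_nonneg_left hs.1 hqM.le
    linarith
  · have hshi : hi < s.1 := by
      by_contra! hle
      exact hcon 0 (by omega) ⟨hslo, hle⟩
    have key : ∀ n < M + 1, 1 - ((steerNext q lo hi b)^[n] s).1 = q ^ n * (1 - s.1) ∧
        hi < ((steerNext q lo hi b)^[n] s).1 := by
      intro n
      induction n with
      | zero => intro _; simpa using hshi
      | succ n ih =>
        intro hn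
        obtain ⟨he, hl⟩ := ih (by omega)
        have hnot := hcon (n + 1) hn
        rw [Function.iterate_succ_apply', steerNext_fst_of_gt (by linarith) hl] at hnot ⊢
        refine ⟨by rw [pow_succ]; linear_combination q * he, ?_⟩
        by_contra! hge
        exact hnot ⟨by nlinarith, hge⟩
    obtain ⟨he, hl⟩ := key M (by omega)
    have := mul_le_mul_of_nonneg_left (show δ ≤ 1 - s.1 by linarith [hs.2]) hqM.le
    linarith

/-! ### Below the golden ratio -/

/-- Below the golden ratio all interior slices have positive dimension. -/
theorem dimH_okamotoSlice_pos {q : ℝ} (h1 : 1 < q) (hG : q < Real.goldenRatio) {y : ℝ}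
    (hy : y ∈ Ioo (0 : ℝ) 1) : 0 < dimH (okamotoSlice q y) := by
  have h2 : q < 2 := hG.trans Real.goldenRatio_lt_two
  have hq : 0 < q := by linarith
  have hsq : q ^ 2 < q + 1 := by
    have := Real.goldenRatio_sq
    nlinarith
  obtain ⟨hy0, hy1⟩ := hy
  set a := 1 / q with ha
  have hqa : q * a = 1 := by rw [ha]; field_simp
  have hgap : 0 < a - q + 1 := by
    have : a - q + 1 = (q + 1 - q ^ 2) / q := by rw [ha]; field_simp; ring
    rw [this]
    exact div_pos (by linarith) hq
  have ha0 : 0 < a := by positivity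
  have ha1 : a < 1 := by nlinarith
  have ha2 : 1 / 2 < a := one_div_lt_one_div_of_lt (by linarith) h2
  -- The overlap is shrunk by ε at both ends, so that free steps stay in [qε, 1 - qε]. The first two
  -- bounds put y there, the third prevents jumping over the shrunken interval, the fourth keeps it
  -- nonempty.
  obtain ⟨ε, hε, he1, he2, he3, he4⟩ : ∃ ε, 0 < ε ∧ q * ε ≤ y ∧ q * ε ≤ 1 - y ∧
      (1 + q) * ε ≤ a - q + 1 ∧ 2 * q * ε ≤ 2 - q := by
    refine ⟨min (min (y / q) ((1 - y) / q)) (min ((a - q + 1) / (1 + q)) ((2 - q) / (2 * q))),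
      ?_, ?_, ?_, ?_, ?_⟩
    · have : 0 < 1 - y := by linarith
      have : 0 < 2 - q := by linarith
      positivity
    · rw [← le_div_iff₀' hq]
      exact (min_le_left _ _).trans (min_le_left _ _)
    · rw [← le_div_iff₀' hq]
      exact (min_le_left _ _).trans (min_le_right _ _)
    · rw [← le_div_iff₀' (by linarith)]
      exact (min_le_right _ _).trans (min_le_left _ _)
    · rw [← le_div_iff₀' (by linarith)]
      exact (min_le_right _ _).trans (min_le_right _ _)
  have hqε : 0 < q * ε := mul_pos hq hε
  have hεq : ε < q * ε := by nlinarith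
  obtain ⟨M, hM⟩ := pow_unbounded_of_one_lt (1 / (q * ε)) h1
  rw [div_lt_iff₀ hqε] at hM
  refine dimH_okamotoSlice_pos_of_visits (lo := 1 - a + ε) (hi := a - ε)
    (W := Icc (q * ε) (1 - q * ε)) (N := M + 1) h1 h2 ⟨fun z hz => ⟨by linarith [hz.1],
      by linarith [hz.2]⟩, fun z hz => ⟨fun hlt => ?_, fun hlt => ?_, fun hl hr b => ?_⟩⟩
    ⟨by linarith, by linarith⟩ fun b s hs => ?_
  · obtain ⟨hz0, hz1⟩ := hz
    simp only [outerInverse, cond_false]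
    constructor <;> nlinarith
  · obtain ⟨hz0, hz1⟩ := hz
    simp only [outerInverse, cond_true]
    constructor <;> nlinarith
  · obtain ⟨hz0, hz1⟩ := hz
    cases b
    · simp only [outerInverse, cond_false]
      constructor <;> nlinarith
    · simp only [outerInverse, cond_true]
      constructor <;> nlinarith
  · refine exists_visit_le ?_ ?_ ?_ ?_ ?_ h1 hM b hs <;> nlinarith

/-! ### Reachability and small exceptional sets -/

/-- The heights in the unit interval from which `D` cannot be reached. -/
def avoiding (q : ℝ) (D : Set ℝ) : Set ℝ :=
  {y | y ∈ Icc (0 : ℝ) 1 ∧ ∀ z ∈ D, ¬ OuterReach q y z}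

theorem mem_avoiding_of_step {q y z : ℝ} {D : Set ℝ} (hy : y ∈ avoiding q D)
    (h : OuterStep q y z) : z ∈ avoiding q D :=
  ⟨h.1, fun w hw hr => hy.2 w hw (Relation.ReflTransGen.head h hr)⟩

theorem steerInvariant_avoiding {q : ℝ} (h1 : 1 < q) (h2 : q < 2) (D : Set ℝ) :
    SteerInvariant q (1 - 1 / q) (1 / q) (avoiding q D) := by
  have ha2 : 1 / 2 < 1 / q := one_div_lt_one_div_of_lt (by linarith) h2
  refine ⟨fun y hy => hy.1, fun y hy => ⟨fun h => ?_, fun h => ?_, fun hl hr b => ?_⟩⟩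
  · exact mem_avoiding_of_step hy (outerStep_outerInverse h1
      (outerInverse_false_mem h1 hy.1.1 (by linarith)))
  · exact mem_avoiding_of_step hy (outerStep_outerInverse h1
      (outerInverse_true_mem h1 (by linarith) hy.1.2))
  · refine mem_avoiding_of_step hy (outerStep_outerInverse h1 ?_)
    cases b
    · exact outerInverse_false_mem h1 hy.1.1 hr
    · exact outerInverse_true_mem h1 hl hy.1.2

/-- The union of the images of `A` under the two orientation-preserving branches. -/
def outerImage (q : ℝ) (A : Set ℝ) : Set ℝ :=
  outerBranch q false '' A ∪ outerBranch q true '' A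

/-- Running backwards from `D` applies finitely many affine branches, so countability and nullity of
`D` pass to the heights that reach it. -/
theorem setOf_reach_subset (q : ℝ) (D : Set ℝ) :
    {y | ∃ z ∈ D, OuterReach q y z} ⊆ ⋃ n, (outerImage q)^[n] D := by
  rintro y ⟨z, hz, h⟩
  induction h using Relation.ReflTransGen.head_induction_on with
  | refl => exact mem_iUnion.2 ⟨0, hz⟩
  | head hs _ ih =>
    obtain ⟨n, hn⟩ := mem_iUnion.1 ih
    obtain ⟨-, b, rfl⟩ := hs
    refine mem_iUnion.2 ⟨n + 1, ?_⟩
    rw [Function.iterate_succ_apply']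
    cases b
    · exact Or.inl ⟨_, hn, rfl⟩
    · exact Or.inr ⟨_, hn, rfl⟩

theorem countable_setOf_reach (q : ℝ) {D : Set ℝ} (hD : D.Countable) :
    {y | ∃ z ∈ D, OuterReach q y z}.Countable := by
  refine (countable_iUnion fun n => ?_).mono (setOf_reach_subset q D)
  induction n with
  | zero => exact hD
  | succ n ih =>
    rw [Function.iterate_succ_apply']
    exact (ih.image _).union (ih.image _)

theorem volume_setOf_reach_eq_zero (q : ℝ) {D : Set ℝ} (hD : volume D = 0) :
    volume {y | ∃ z ∈ D, OuterReach q y z} = 0 := by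
  refine measure_mono_null (setOf_reach_subset q D) (measure_iUnion_null fun n => ?_)
  induction n with
  | zero => exact hD
  | succ n ih =>
    rw [Function.iterate_succ_apply']
    refine measure_union_null ?_ ?_ <;>
      refine addHaar_image_eq_zero_of_differentiableOn_of_addHaar_eq_zero volume ?_ ih <;>
      refine Differentiable.differentiableOn ?_ <;>
      unfold outerBranch <;> dsimp only [cond_true, cond_false] <;> fun_prop

/-! ### One-point slices above the golden ratio -/

/-- The slice at `y / q ^ n` is a copy of the slice at `y`. -/
theorem exists_okamotoSlice_div_pow {q y : ℝ} (h1 : 1 < q) (h2 : q < 2) (h0 : 0 < y)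
    (hy : y ≤ 1 - 1 / q) (n : ℕ) : ∃ g : ℝ → ℝ, Function.Injective g ∧
      okamotoSlice q (y / q ^ n) = g '' okamotoSlice q y := by
  have hq : 0 < q := by linarith
  induction n with
  | zero => exact ⟨id, Function.injective_id, by simp⟩
  | succ n ih =>
    obtain ⟨g, hg, he⟩ := ih
    refine ⟨okamotoV 0 ∘ g, (okamotoV_injective 0).comp hg, ?_⟩
    rw [okamotoSlice_eq_image_zero h1 h2 (by positivity), image_comp, ← he,
      show q * (y / q ^ (n + 1)) = y / q ^ n by rw [pow_succ]; field_simp]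
    refine lt_of_lt_of_le ?_ hy
    exact div_lt_self h0 (one_lt_pow₀ h1 (by omega))

theorem div_pow_injective {q y : ℝ} (h1 : 1 < q) (h0 : 0 < y) :
    Function.Injective fun n : ℕ => y / q ^ n := by
  intro m n h
  simp only at h
  have hq : 0 < q := by linarith
  rw [div_eq_div_iff (by positivity) (by positivity)] at h
  exact (pow_right_injective₀ hq h1.ne' (mul_left_cancel₀ h0.ne' h)).symm

/-- At height `1 / (q + 1)` the slice is a single point above the golden ratio. -/
theorem okamotoSlice_inv_add_one {q : ℝ} (hG : Real.goldenRatio < q) (h2 : q < 2) :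
    1 / (q + 1) < 1 - 1 / q ∧ okamotoSlice q (1 / (q + 1)) = {1 / 4} := by
  have h1 : 1 < q := Real.one_lt_goldenRatio.trans hG
  have hq : 0 < q := by linarith
  have hsq : q + 1 < q ^ 2 := by
    have := Real.goldenRatio_sq
    nlinarith [Real.goldenRatio_pos]
  have hlt : 1 / (q + 1) < 1 - 1 / q := by
    rw [← sub_pos, show 1 - 1 / q - 1 / (q + 1) = (q ^ 2 - (q + 1)) / (q * (q + 1)) by
      field_simp; ring]
    exact div_pos (by linarith) (by positivity)
  have hgt : 1 / q < q * (1 / (q + 1)) := by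
    rw [mul_one_div, div_lt_div_iff₀ hq (by linarith)]
    nlinarith
  have hle : q * (1 / (q + 1)) ≤ 1 := by
    rw [mul_one_div, div_le_one (by linarith)]
    linarith
  -- The 2-cycle lies alternately below and above the overlap, which forces the digits 0, 2, 0, 2,
  -- …, the ternary expansion of 1/4.
  have hcyc : q * (q * (1 / (q + 1))) - (q - 1) = 1 / (q + 1) := by
    field_simp
    ring
  have hpos : 0 < 1 / (q + 1) := by positivity
  refine ⟨hlt, Subset.antisymm ?_ ?_⟩
  · refine subset_singleton_of_contracting (r := 1 / 9) (fun x hx => hx.1) (by norm_num)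
      (by norm_num) fun x hx => ?_
    rw [okamotoSlice_eq_image_zero h1 h2 hpos.le hlt, okamotoSlice_eq_image_two h1 h2 hgt hle,
      hcyc] at hx
    obtain ⟨_, ⟨x', hx', rfl⟩, rfl⟩ := hx
    refine ⟨x', hx', le_of_eq ?_⟩
    rw [show okamotoV 0 (okamotoV 2 x') - 1 / 4 = 1 / 9 * (x' - 1 / 4) by
      simp [okamotoV]; ring, abs_mul, abs_of_pos (by norm_num)]
  · rw [singleton_subset_iff, mem_okamotoSlice_iff h1 h2]
    have := mem_okamotoGraph_of_orbit h1 h2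
      (fun n => if Even n then (1 / 4, 1 / (q + 1)) else (3 / 4, q * (1 / (q + 1))))
      (fun n => ?_) (fun n => ?_)
    · simpa using this
    · split_ifs
      · exact ⟨by norm_num, hpos.le, (hlt.trans (sub_lt_self 1 (by positivity))).le⟩
      · exact ⟨by norm_num, by positivity, hle⟩
    · by_cases hn : Even n
      · refine ⟨0, ?_⟩
        have hn' : ¬ Even (n + 1) := by simpa [Nat.even_add_one] using hn
        simp only [if_pos hn, if_neg hn']
        refine Prod.ext ?_ ?_
        · norm_num [okamotoMap, okamotoV]
        · simp [okamotoMap, okamotoU]; field_simp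
      · refine ⟨2, ?_⟩
        have hn' : Even (n + 1) := by simpa [Nat.even_add_one] using hn
        simp only [if_neg hn, if_pos hn']
        refine Prod.ext ?_ ?_
        · norm_num [okamotoMap, okamotoV]
        · simp [okamotoMap, okamotoU]; field_simp; ring

theorem infinite_setOf_existsUnique_mem_okamotoSlice {q : ℝ} (hG : Real.goldenRatio < q)
    (h2 : q < 2) : {y ∈ Ioo (0 : ℝ) 1 | ∃! x : ℝ, x ∈ okamotoSlice q y}.Infinite := by
  have h1 : 1 < q := Real.one_lt_goldenRatio.trans hG
  have hpos : 0 < 1 / (q + 1) := by positivity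
  obtain ⟨hlt, he⟩ := okamotoSlice_inv_add_one hG h2
  refine infinite_of_injective_forall_mem (div_pow_injective h1 hpos) fun n => ⟨⟨?_, ?_⟩, ?_⟩
  · positivity
  · refine (div_le_self hpos.le (one_le_pow₀ h1.le)).trans_lt ?_
    rw [div_lt_one (by positivity)]
    linarith
  · obtain ⟨g, -, hg⟩ := exists_okamotoSlice_div_pow h1 h2 hpos hlt.le n
    rw [he, image_singleton] at hg
    exact ⟨g (1 / 4), hg ▸ mem_singleton _, fun x hx => by rw [hg] at hx; exact hx⟩

/-! ### Almost every height -/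

/-- The heights whose orbit never meets the overlap interval. -/
def forcedHeights (q : ℝ) : Set ℝ :=
  avoiding q (Icc (1 - 1 / q) (1 / q))

/-- Composing n branches along an expansion of y gives an interval of length q^(-n) around y, each
of whose points reaches its rescaled copy in [0,1]. -/
theorem exists_affine_reach {q : ℝ} (h1 : 1 < q) (h2 : q < 2) (n : ℕ) {y : ℝ}
    (hy : y ∈ Icc (0 : ℝ) 1) : ∃ c, ∃ z ∈ Icc (0 : ℝ) 1, y = (1 / q) ^ n * z + c ∧
      ∀ w ∈ Icc (0 : ℝ) 1, OuterReach q ((1 / q) ^ n * w + c) w := by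
  have ha2 : 1 / 2 < 1 / q := one_div_lt_one_div_of_lt (by linarith) h2
  induction n with
  | zero => exact ⟨0, y, hy, by simp, fun w _ => by
      rw [pow_zero, one_mul, add_zero]
      exact Relation.ReflTransGen.refl⟩
  | succ n ih =>
    obtain ⟨c, z, hz, rfl, hr⟩ := ih
    obtain ⟨b, hb⟩ : ∃ b, outerInverse q b z ∈ Icc (0 : ℝ) 1 := by
      rcases le_total z (1 / q) with h | h
      · exact ⟨false, outerInverse_false_mem h1 hz.1 h⟩
      · exact ⟨true, outerInverse_true_mem h1 (by linarith) hz.2⟩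
    have haff : ∀ w, outerBranch q b w = 1 / q * w + outerBranch q b 0 := by
      intro w
      cases b <;> simp [outerBranch, div_eq_mul_inv, mul_comm]
    have hpow : ∀ w, (1 / q) ^ (n + 1) * w + ((1 / q) ^ n * outerBranch q b 0 + c)
        = (1 / q) ^ n * outerBranch q b w + c := by
      intro w
      rw [haff w]
      ring
    refine ⟨(1 / q) ^ n * outerBranch q b 0 + c, outerInverse q b z, hb, ?_, fun w hw => ?_⟩
    · rw [hpow, outerBranch_outerInverse (by linarith)]
    · rw [hpow]
      exact (hr _ (outerBranch_mem_Icc h1 b hw)).tail ⟨hw, b, rfl⟩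

theorem volume_forcedHeights_lt_one {q : ℝ} (h1 : 1 < q) (h2 : q < 2) :
    volume (forcedHeights q) < 1 := by
  have hq : 0 < q := by linarith
  have ha2 : 1 / 2 < 1 / q := one_div_lt_one_div_of_lt (by linarith) h2
  have h5 : 1 / q < 1 := by rw [div_lt_one hq]; exact h1
  have hsub : forcedHeights q ⊆ Icc 0 (1 - 1 / q) ∪ Icc (1 / q) 1 := by
    rintro y ⟨⟨hy0, hy1⟩, hy⟩
    by_contra hcon
    rw [mem_union, not_or, mem_Icc, mem_Icc] at hcon
    push Not at hcon
    refine hy y ⟨(hcon.1 hy0).le, ?_⟩ Relation.ReflTransGen.refl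
    by_contra! h
    linarith [hcon.2 h.le]
  refine (measure_mono hsub).trans_lt ((measure_union_le _ _).trans_lt ?_)
  rw [Real.volume_Icc, Real.volume_Icc, ← ENNReal.ofReal_add (by linarith) (by linarith),
    ENNReal.ofReal_lt_one]
  linarith

/-- In the interval of length q^(-n) around a forced height, the forced heights lie in a scaled copy
of the whole forced set. Their density there is at most the measure of that set, which is less than
1, so no forced height is a density point. -/
theorem volume_forcedHeights {q : ℝ} (h1 : 1 < q) (h2 : q < 2) :
    volume (forcedHeights q) = 0 := by
  have hq : 0 < q := by linarith
  have ha0 : 0 < 1 / q := by positivity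
  have ha1 : 1 / q < 1 := by rw [div_lt_one hq]; exact h1
  -- The constant 1 asks only that the balls contain y, not that they be centred at it.
  have hae := IsUnifLocDoublingMeasure.ae_tendsto_measure_inter_div (volume : Measure ℝ)
    (forcedHeights q) 1
  have hnot : ∀ᵐ y ∂volume.restrict (forcedHeights q), y ∉ forcedHeights q := by
    filter_upwards [hae] with y hy hmem
    choose c z hz hyc hr using fun n => exists_affine_reach h1 h2 n hmem.1
    have hball : ∀ n, Metric.closedBall (c n + (1 / q) ^ n / 2) ((1 / q) ^ n / 2)
        = Icc (c n) (c n + (1 / q) ^ n) := by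
      intro n
      rw [Real.closedBall_eq_Icc]
      congr 1 <;> ring
    have hlim := hy (l := atTop) (fun n => c n + (1 / q) ^ n / 2) (fun n => (1 / q) ^ n / 2) ?_ ?_
    · refine absurd (le_of_tendsto' hlim fun n => ?_) (volume_forcedHeights_lt_one h1 h2).not_ge
      have hsub : forcedHeights q ∩ Icc (c n) (c n + (1 / q) ^ n) ⊆
          (fun x => x + c n) '' ((1 / q) ^ n • forcedHeights q) := by
        rintro v ⟨hv, hv0, hv1⟩
        have hpow : 0 < (1 / q) ^ n := by positivity
        have hw : (v - c n) / (1 / q) ^ n ∈ Icc (0 : ℝ) 1 := by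
          constructor
          · exact div_nonneg (by linarith) hpow.le
          · rw [div_le_one hpow]
            linarith
        have he : (1 / q) ^ n * ((v - c n) / (1 / q) ^ n) + c n = v := by
          rw [mul_div_cancel₀ _ hpow.ne']
          ring
        have hreach := hr n _ hw
        rw [he] at hreach
        refine ⟨(1 / q) ^ n • ((v - c n) / (1 / q) ^ n), smul_mem_smul_set ⟨hw, fun u hu hru => ?_⟩,
          he⟩
        exact hv.2 u hu (hreach.trans hru)
      rw [hball]
      refine ENNReal.div_le_of_le_mul ((measure_mono hsub).trans ?_)
      rw [image_add_right, measure_preimage_add_right, Measure.addHaar_smul, Real.volume_Icc,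
        mul_comm]
      simp only [Module.finrank_self, pow_one, add_sub_cancel_left]
      rw [abs_of_pos (by positivity)]
    · refine tendsto_nhdsWithin_iff.2 ⟨?_, Eventually.of_forall fun n => ?_⟩
      · simpa using (tendsto_pow_atTop_nhds_zero_of_lt_one ha0.le ha1).div_const 2
      · rw [mem_Ioi]
        positivity
    · refine Eventually.of_forall fun n => ?_
      have hpow : 0 < (1 / q) ^ n := by positivity
      rw [one_mul, hball, hyc n]
      constructor <;> nlinarith [(hz n).1, (hz n).2]
  rw [ae_iff] at hnot
  simpa using hnot

/-- Every height outside the preimages of the forced ones visits the overlap interval. -/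
theorem exists_visit_of_reach {q : ℝ} (h1 : 1 < q) (b : ℕ → Bool) {y z : ℝ}
    (h : OuterReach q y z) (hz : z ∈ Icc (1 - 1 / q) (1 / q)) {s : ℝ × ℕ} (hs : s.1 = y) :
    ∃ n, ((steerNext q (1 - 1 / q) (1 / q) b)^[n] s).1 ∈ Icc (1 - 1 / q) (1 / q) := by
  have hq : 0 < q := by linarith
  induction h using Relation.ReflTransGen.head_induction_on generalizing s with
  | refl => exact ⟨0, by simpa [hs] using hz⟩
  | @head y y' hstep _ ih =>
    by_cases hI : y ∈ Icc (1 - 1 / q) (1 / q)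
    · exact ⟨0, by simpa [hs] using hI⟩
    -- Off the overlap only one branch can be inverted, so the steered step is the given one.
    suffices hnext : (steerNext q (1 - 1 / q) (1 / q) b s).1 = y' by
      obtain ⟨n, hn⟩ := ih hnext
      exact ⟨n + 1, hn⟩
    obtain ⟨hy', c, rfl⟩ := hstep
    have h3 : 0 ≤ y' / q := div_nonneg hy'.1 hq.le
    have h4 : y' / q ≤ 1 / q := by gcongr; exact hy'.2
    cases c
    · simp only [outerBranch, cond_false, mem_Icc, not_and_or, not_le] at hI hs
      rw [steerNext_fst_of_lt (by rw [hs]; exact hI.resolve_right (by linarith)), hs]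
      field_simp
    · simp only [outerBranch, cond_true, mem_Icc, not_and_or, not_le] at hI hs
      rw [steerNext_fst_of_gt (by rw [hs]; linarith)
        (by rw [hs]; exact hI.resolve_left (by linarith)), hs]
      field_simp
      ring

/-- No state of the steered process is a forced height, so each one reaches the overlap again. -/
theorem not_countable_okamotoSlice_of_mem_avoiding {q y : ℝ} (h1 : 1 < q) (h2 : q < 2)
    (hy : y ∈ avoiding q (forcedHeights q)) : ¬ (okamotoSlice q y).Countable := by
  refine not_countable_okamotoSlice_of_visits h1 h2 (steerInvariant_avoiding h1 h2 _) hy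
    fun b s hs => ?_
  have hnot : s.1 ∉ forcedHeights q := fun h => hs.2 _ h Relation.ReflTransGen.refl
  obtain ⟨z, hz, hr⟩ : ∃ z ∈ Icc (1 - 1 / q) (1 / q), OuterReach q s.1 z := by
    by_contra! hcon
    exact hnot ⟨hs.1, hcon⟩
  exact exists_visit_of_reach h1 b hr hz rfl

theorem ae_not_countable_okamotoSlice {q : ℝ} (h1 : 1 < q) (h2 : q < 2) :
    ∀ᵐ y ∂(volume.restrict (Ioo (0 : ℝ) 1)), ¬ (okamotoSlice q y).Countable := by
  rw [ae_restrict_iff' measurableSet_Ioo, ae_iff]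
  refine measure_mono_null (fun y hy => ?_)
    (volume_setOf_reach_eq_zero q (volume_forcedHeights h1 h2))
  by_contra hcon
  refine hy fun hy01 => not_countable_okamotoSlice_of_mem_avoiding h1 h2
    ⟨Ioo_subset_Icc_self hy01, fun z hz hr => hcon ⟨z, hz, hr⟩⟩

theorem okamotoSlice_zero {q : ℝ} (h1 : 1 < q) (h2 : q < 2) : okamotoSlice q 0 = {0} := by
  have h5 : 1 / q < 1 := by rw [div_lt_one (by linarith)]; exact h1
  refine Subset.antisymm ?_ ?_
  · refine subset_singleton_of_contracting (r := 1 / 3) (fun x hx => hx.1) (by norm_num)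
      (by norm_num) fun x hx => ?_
    rw [okamotoSlice_eq_image_zero h1 h2 le_rfl (by linarith), mul_zero] at hx
    obtain ⟨x', hx', rfl⟩ := hx
    refine ⟨x', hx', le_of_eq ?_⟩
    rw [show okamotoV 0 x' - 0 = 1 / 3 * (x' - 0) by simp [okamotoV]; ring, abs_mul,
      abs_of_pos (by norm_num)]
  · rw [singleton_subset_iff, mem_okamotoSlice_iff h1 h2]
    exact mem_okamotoGraph_of_orbit h1 h2 (fun _ => (0, 0)) (fun _ => by simp)
      fun _ => ⟨0, by simp [okamotoMap, okamotoV, okamotoU]⟩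

theorem okamotoSlice_one {q : ℝ} (h1 : 1 < q) (h2 : q < 2) : okamotoSlice q 1 = {1} := by
  have h5 : 1 / q < 1 := by rw [div_lt_one (by linarith)]; exact h1
  refine Subset.antisymm ?_ ?_
  · refine subset_singleton_of_contracting (r := 1 / 3) (fun x hx => hx.1) (by norm_num)
      (by norm_num) fun x hx => ?_
    rw [okamotoSlice_eq_image_two h1 h2 h5 le_rfl, show q * 1 - (q - 1) = 1 by ring] at hx
    obtain ⟨x', hx', rfl⟩ := hx
    refine ⟨x', hx', le_of_eq ?_⟩
    rw [show okamotoV 2 x' - 1 = 1 / 3 * (x' - 1) by simp [okamotoV]; ring, abs_mul,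
      abs_of_pos (by norm_num)]
  · rw [singleton_subset_iff, mem_okamotoSlice_iff h1 h2]
    refine mem_okamotoGraph_of_orbit h1 h2 (fun _ => (1, 1)) (fun _ => by simp)
      fun _ => ⟨2, ?_⟩
    refine Prod.ext ?_ ?_
    · norm_num [okamotoMap, okamotoV]
    · simp [okamotoMap, okamotoU]

/-! ### At the golden ratio -/

section GoldenRatio

open Real

theorem one_div_goldenRatio : 1 / goldenRatio = goldenRatio - 1 := by
  rw [div_eq_iff goldenRatio_ne_zero]
  linear_combination -goldenRatio_sq

theorem div_goldenRatio (z : ℝ) : z / goldenRatio = z * (goldenRatio - 1) := by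
  rw [div_eq_mul_one_div, one_div_goldenRatio]

/-- At the golden ratio, the slice at the right end of the overlap interval. -/
theorem mem_okamotoSlice_one_div_goldenRatio {x : ℝ} :
    x ∈ okamotoSlice goldenRatio (1 / goldenRatio) ↔
      x = 1 / 3 ∨ x ∈ okamotoV 2 '' okamotoSlice goldenRatio (1 - 1 / goldenRatio) := by
  have h1 := one_lt_goldenRatio
  have h2 := goldenRatio_lt_two
  have hsq := goldenRatio_sq
  rw [mem_okamotoSlice_iff_exists h1 h2]
  constructor
  · rintro ⟨i, y', hy', x', hx', rfl, hu⟩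
    simp only [okamotoU, div_goldenRatio] at hu
    -- The height 1/G comes from 1 under `u_0` and from 0 under `u_1`, both giving x = 1/3, and from
    -- 1 - 1/G under `u_2`.
    fin_cases i <;> simp at hu
    · obtain rfl : y' = 1 := by
        have : (goldenRatio - 1) * (y' - 1) = 0 := by linear_combination -hu
        exact sub_eq_zero.1 ((mul_eq_zero.1 this).resolve_left (by linarith))
      rw [okamotoSlice_one h1 h2] at hx'
      left
      rw [mem_singleton_iff.1 hx']
      norm_num [okamotoV]
    · obtain rfl : y' = 0 := by
        have : (2 * goldenRatio - 3) * y' = 0 := by linear_combination hu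
        refine (mul_eq_zero.1 this).resolve_left fun h => ?_
        nlinarith
      rw [okamotoSlice_zero h1 h2] at hx'
      left
      rw [mem_singleton_iff.1 hx']
      norm_num [okamotoV]
    · right
      refine ⟨x', ?_, rfl⟩
      convert hx' using 2
      rw [one_div_goldenRatio]
      have : (goldenRatio - 1) * (1 - (goldenRatio - 1) - y') = 0 := by
        linear_combination hu - hsq
      exact sub_eq_zero.1 ((mul_eq_zero.1 this).resolve_left (by linarith))
  · rintro (rfl | ⟨x', hx', rfl⟩)
    · refine ⟨0, 1, by simp, 1, by rw [okamotoSlice_one h1 h2]; rfl, ?_, by simp [okamotoU]⟩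
      norm_num [okamotoV]
    · refine ⟨2, 1 - 1 / goldenRatio, ?_, x', hx', rfl, ?_⟩
      · rw [one_div_goldenRatio]
        constructor <;> linarith
      · simp only [okamotoU, div_goldenRatio]
        simp
        linear_combination hsq

/-- At the golden ratio, the slice at the left end of the overlap interval. -/
theorem mem_okamotoSlice_one_sub_one_div_goldenRatio {x : ℝ} :
    x ∈ okamotoSlice goldenRatio (1 - 1 / goldenRatio) ↔
      x = 2 / 3 ∨ x ∈ okamotoV 0 '' okamotoSlice goldenRatio (1 / goldenRatio) := by
  have h1 := one_lt_goldenRatio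
  have h2 := goldenRatio_lt_two
  have hsq := goldenRatio_sq
  rw [mem_okamotoSlice_iff_exists h1 h2]
  constructor
  · rintro ⟨i, y', hy', x', hx', rfl, hu⟩
    simp only [okamotoU, div_goldenRatio] at hu
    fin_cases i <;> simp at hu
    · right
      refine ⟨x', ?_, rfl⟩
      convert hx' using 2
      rw [one_div_goldenRatio]
      have : (goldenRatio - 1) * ((goldenRatio - 1) - y') = 0 := by
        linear_combination hu + hsq
      exact sub_eq_zero.1 ((mul_eq_zero.1 this).resolve_left (by linarith))
    · obtain rfl : y' = 1 := by
        rcases hu with hu | hu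
        · nlinarith
        · linarith
      rw [okamotoSlice_one h1 h2] at hx'
      left
      rw [mem_singleton_iff.1 hx']
      norm_num [okamotoV]
    · obtain rfl : y' = 0 := by
        rcases hu with hu | hu
        · exact hu
        · linarith
      rw [okamotoSlice_zero h1 h2] at hx'
      left
      rw [mem_singleton_iff.1 hx']
      norm_num [okamotoV]
  · rintro (rfl | ⟨x', hx', rfl⟩)
    · refine ⟨2, 0, by simp, 0, by rw [okamotoSlice_zero h1 h2]; rfl, ?_, by simp [okamotoU]⟩
      norm_num [okamotoV]
    · refine ⟨0, 1 / goldenRatio, ?_, x', hx', rfl, ?_⟩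
      · rw [one_div_goldenRatio]
        constructor <;> linarith
      · simp only [okamotoU, div_goldenRatio]
        simp
        linear_combination -hsq

/-- The two ends of the overlap lead to each other, so the slice consists of two points and its own
image under `v_2 ∘ v_0`, which fixes 3/4. -/
theorem mem_okamotoSlice_one_div_goldenRatio' {x : ℝ} :
    x ∈ okamotoSlice goldenRatio (1 / goldenRatio) ↔ x = 1 / 3 ∨ x = 8 / 9 ∨
      ∃ x' ∈ okamotoSlice goldenRatio (1 / goldenRatio), x = x' / 9 + 2 / 3 := by
  rw [mem_okamotoSlice_one_div_goldenRatio]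
  refine or_congr_right ?_
  constructor
  · rintro ⟨w, hw, rfl⟩
    rcases mem_okamotoSlice_one_sub_one_div_goldenRatio.1 hw with rfl | ⟨x', hx', rfl⟩
    · left
      norm_num [okamotoV]
    · refine Or.inr ⟨x', hx', ?_⟩
      simp [okamotoV]
      ring
  · rintro (rfl | ⟨x', hx', rfl⟩)
    · refine ⟨_, mem_okamotoSlice_one_sub_one_div_goldenRatio.2 (Or.inl rfl), ?_⟩
      norm_num [okamotoV]
    · refine ⟨_, mem_okamotoSlice_one_sub_one_div_goldenRatio.2 (Or.inr ⟨x', hx', rfl⟩), ?_⟩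
      simp [okamotoV]
      ring

theorem infinite_okamotoSlice_one_div_goldenRatio :
    (okamotoSlice goldenRatio (1 / goldenRatio)).Infinite := by
  -- This is the orbit of 1/3 under x ↦ x/9 + 2/3.
  have hinj : Function.Injective fun n : ℕ => 3 / 4 - 5 / 12 / (9 : ℝ) ^ n := fun m n h =>
    div_pow_injective (q := 9) (y := 5 / 12) (by norm_num) (by norm_num) (sub_right_injective h)
  refine infinite_of_injective_forall_mem hinj fun n => ?_
  induction n with
  | zero => exact mem_okamotoSlice_one_div_goldenRatio'.2 (Or.inl (by norm_num))
  | succ n ih =>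
    refine mem_okamotoSlice_one_div_goldenRatio'.2 (Or.inr (Or.inr ⟨_, ih, ?_⟩))
    rw [pow_succ]
    field_simp
    ring

/-- The seeds 1/3 and 8/9 are rational and the map preserves rationality, so an irrational point
would have irrational preimages in the slice forever, which forces it to be the fixed point 3/4. -/
theorem countable_okamotoSlice_one_div_goldenRatio :
    (okamotoSlice goldenRatio (1 / goldenRatio)).Countable := by
  have hirr : okamotoSlice goldenRatio (1 / goldenRatio) \ range ((↑) : ℚ → ℝ) ⊆ {3 / 4} := by
    refine subset_singleton_of_contracting (r := 1 / 9) (fun x hx => hx.1.1) (by norm_num)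
      (by norm_num) fun x hx => ?_
    obtain ⟨hx, hirr⟩ := hx
    rcases mem_okamotoSlice_one_div_goldenRatio'.1 hx with rfl | rfl | ⟨x', hx', rfl⟩
    · exact absurd ⟨1 / 3, by norm_num⟩ hirr
    · exact absurd ⟨8 / 9, by norm_num⟩ hirr
    · refine ⟨x', ⟨hx', ?_⟩, le_of_eq ?_⟩
      · rintro ⟨r, rfl⟩
        exact hirr ⟨r / 9 + 2 / 3, by push_cast; rfl⟩
      · rw [show x' / 9 + 2 / 3 - 3 / 4 = 1 / 9 * (x' - 3 / 4) by ring, abs_mul,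
          abs_of_pos (by norm_num)]
  refine ((countable_range ((↑) : ℚ → ℝ)).union (countable_singleton (3 / 4 : ℝ))).mono
    fun x hx => ?_
  by_cases h : x ∈ range ((↑) : ℚ → ℝ)
  · exact Or.inl h
  · exact Or.inr (hirr ⟨hx, h⟩)

theorem countable_and_infinite_okamotoSlice_one_sub_one_div_goldenRatio :
    (okamotoSlice goldenRatio (1 - 1 / goldenRatio)).Countable ∧
      (okamotoSlice goldenRatio (1 - 1 / goldenRatio)).Infinite := by
  constructor
  · refine ((countable_singleton (2 / 3 : ℝ)).union
      (countable_okamotoSlice_one_div_goldenRatio.image (okamotoV 0))).mono fun x hx => ?_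
    exact mem_okamotoSlice_one_sub_one_div_goldenRatio.1 hx
  · refine (infinite_okamotoSlice_one_div_goldenRatio.image
      (okamotoV_injective 0).injOn).mono fun x hx => ?_
    exact mem_okamotoSlice_one_sub_one_div_goldenRatio.2 (Or.inr hx)

theorem infinite_setOf_countable_infinite_okamotoSlice_goldenRatio :
    {y ∈ Ioo (0 : ℝ) 1 | (okamotoSlice goldenRatio y).Countable ∧
      (okamotoSlice goldenRatio y).Infinite}.Infinite := by
  have h1 := one_lt_goldenRatio
  have h2 := goldenRatio_lt_two
  have hpos : 0 < 1 - 1 / goldenRatio := by rw [one_div_goldenRatio]; linarith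
  refine infinite_of_injective_forall_mem (div_pow_injective h1 hpos) fun n => ⟨⟨?_, ?_⟩, ?_⟩
  · positivity
  · refine (div_le_self hpos.le (one_le_pow₀ h1.le)).trans_lt ?_
    rw [one_div_goldenRatio]
    linarith
  · obtain ⟨g, hg, he⟩ := exists_okamotoSlice_div_pow h1 h2 hpos le_rfl n
    rw [he]
    obtain ⟨hc, hi⟩ := countable_and_infinite_okamotoSlice_one_sub_one_div_goldenRatio
    exact ⟨hc.image g, hi.image hg.injOn⟩

/-- At the golden ratio, interior heights from which an endpoint can be reached have infinite
slices. -/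
theorem infinite_okamotoSlice_goldenRatio_of_reach {y z : ℝ} (hy : y ∈ Ioo (0 : ℝ) 1)
    (hz : z ∈ ({0, 1} : Set ℝ)) (h : OuterReach goldenRatio y z) :
    (okamotoSlice goldenRatio y).Infinite := by
  have h1 := one_lt_goldenRatio
  have h2 := goldenRatio_lt_two
  induction h using Relation.ReflTransGen.head_induction_on with
  | refl =>
    rcases hz with rfl | rfl
    · exact absurd hy.1 (lt_irrefl _)
    · exact absurd hy.2 (lt_irrefl _)
  | @head y y' hs _ ih =>
    by_cases hy' : y' ∈ Ioo (0 : ℝ) 1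
    · exact OuterReach.infinite_okamotoSlice h1 h2 (Relation.ReflTransGen.single hs) (ih hy')
    obtain ⟨⟨h0, h1'⟩, b, rfl⟩ := hs
    have hend : y' = 0 ∨ y' = 1 := by
      by_contra! hcon
      exact hy' ⟨lt_of_le_of_ne h0 hcon.1.symm, lt_of_le_of_ne h1' hcon.2⟩
    -- An interior height steps to 0 only from 1 - 1/G, and to 1 only from 1/G.
    rcases hend with rfl | rfl <;> cases b
    · simp [outerBranch] at hy
    · simpa [outerBranch] using
        countable_and_infinite_okamotoSlice_one_sub_one_div_goldenRatio.2
    · simpa [outerBranch] using infinite_okamotoSlice_one_div_goldenRatio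
    · simp [outerBranch] at hy

/-- Now q(1 - 1/q) = 1/q, so the overlap still cannot be jumped over, but the waiting time depends
on the distance to 0 and 1. Gaps need not be bounded, and only uncountability follows. -/
theorem not_countable_okamotoSlice_goldenRatio {y : ℝ}
    (hy : y ∈ avoiding goldenRatio {0, 1}) : ¬ (okamotoSlice goldenRatio y).Countable := by
  have h1 := one_lt_goldenRatio
  have h2 := goldenRatio_lt_two
  have hsq := goldenRatio_sq
  refine not_countable_okamotoSlice_of_visits h1 h2 (steerInvariant_avoiding h1 h2 _) hy
    fun b s hs => ?_
  have h0 : 0 < s.1 := by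
    refine lt_of_le_of_ne hs.1.1 fun h => hs.2 0 (by simp) ?_
    rw [← h]
    exact Relation.ReflTransGen.refl
  have h1' : s.1 < 1 := by
    refine lt_of_le_of_ne hs.1.2 fun h => hs.2 1 (by simp) ?_
    rw [h]
    exact Relation.ReflTransGen.refl
  have hδ : 0 < min s.1 (1 - s.1) := lt_min h0 (by linarith)
  obtain ⟨M, hM⟩ := pow_unbounded_of_one_lt (1 / min s.1 (1 - s.1)) h1
  rw [div_lt_iff₀ hδ] at hM
  obtain ⟨n, -, hn⟩ := exists_visit_le (q := goldenRatio) (lo := 1 - 1 / goldenRatio)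
    (hi := 1 / goldenRatio) (by rw [one_div_goldenRatio]; linarith)
    (by rw [one_div_goldenRatio]; linarith) (by rw [one_div_goldenRatio]; nlinarith)
    (by rw [one_div_goldenRatio]; nlinarith) (by rw [one_div_goldenRatio]; nlinarith) h1 hM b
    (s := s) ⟨min_le_left _ _, by linarith [min_le_right s.1 (1 - s.1)]⟩
  exact ⟨n, hn⟩

theorem exists_reach_of_countable_okamotoSlice_goldenRatio {y : ℝ} (hy : y ∈ Ioo (0 : ℝ) 1)
    (hc : (okamotoSlice goldenRatio y).Countable) :
    ∃ z ∈ ({0, 1} : Set ℝ), OuterReach goldenRatio y z := by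
  by_contra! hcon
  exact not_countable_okamotoSlice_goldenRatio ⟨Ioo_subset_Icc_self hy, hcon⟩ hc

end GoldenRatio

theorem mainTheorem7 :
    (∀ q : ℝ, 1 < q → q < Real.goldenRatio → ∀ y ∈ Ioo (0 : ℝ) 1,
      ¬ (okamotoSlice q y).Countable ∧ 0 < dimH (okamotoSlice q y)) ∧
    ({y ∈ Ioo (0 : ℝ) 1 | (okamotoSlice Real.goldenRatio y).Countable ∧
        (okamotoSlice Real.goldenRatio y).Infinite}.Countable ∧
      {y ∈ Ioo (0 : ℝ) 1 | (okamotoSlice Real.goldenRatio y).Countable ∧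
        (okamotoSlice Real.goldenRatio y).Infinite}.Infinite ∧
      ∀ y ∈ Ioo (0 : ℝ) 1,
        ¬ ((okamotoSlice Real.goldenRatio y).Countable ∧
          (okamotoSlice Real.goldenRatio y).Infinite) →
        ¬ (okamotoSlice Real.goldenRatio y).Countable) ∧
    (∀ q : ℝ, Real.goldenRatio < q → q < 2 →
      {y ∈ Ioo (0 : ℝ) 1 | ∃! x : ℝ, x ∈ okamotoSlice q y}.Infinite ∧
      ∀ᵐ y ∂(volume.restrict (Ioo (0 : ℝ) 1)), ¬ (okamotoSlice q y).Countable) := by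
  refine ⟨fun q h1 hG y hy => ?_, ⟨?_, ?_, fun y hy hn hc => ?_⟩, fun q hG h2 => ⟨?_, ?_⟩⟩
  · have hpos := dimH_okamotoSlice_pos h1 hG hy
    exact ⟨fun hc => hpos.ne' (dimH_countable hc), hpos⟩
  · refine (countable_setOf_reach Real.goldenRatio (D := {0, 1}) (by simp)).mono ?_
    exact fun y hy => exists_reach_of_countable_okamotoSlice_goldenRatio hy.1 hy.2.1
  · exact infinite_setOf_countable_infinite_okamotoSlice_goldenRatio
  · obtain ⟨z, hz, hr⟩ := exists_reach_of_countable_okamotoSlice_goldenRatio hy hc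
    exact hn ⟨hc, infinite_okamotoSlice_goldenRatio_of_reach hy hz hr⟩
  · exact infinite_setOf_existsUnique_mem_okamotoSlice hG h2
  · exact ae_not_countable_okamotoSlice (Real.one_lt_goldenRatio.trans hG) h2
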